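/- **Corollary (MacDonald Theorem).** Let $n \geq 0$ and let $\omega = (\omega_1, \dots, \omega_n) \in \mathbb{R}_{>0}^n$ have $\mathbb{Q}$-linearly independent coordinates. Let $\mathbb{C}((x))$ be the fraction field of the ring $\mathbb{C}[[x_1, \dots, x_n]]$ of formal power series. For a nonzero $f = \sum_{\alpha \in \mathbb{N}^n} f_\alpha x^\alpha \in \mathbb{C}[[x]]$ put $\nu_\omega(f) = \min\{\langle \omega, \alpha\rangle \mid f_\alpha \neq 0\}$; let $|f/g|_\omega = e^{-(\nu_\omega(f) - \nu_\omega(g))}$ for nonzero $f, g \in \mathbb{C}[[x]]$, and $|0|_\omega = 0$. Let $\widehat{\mathbb{C}((x))}^{\omega}$ be the completion of $\mathbb{C}((x))$ with respect to the norm $|\cdot|_\omega$. Let $\xi \in \widehat{\mathbb{C}((x))}^{\omega}$ be algebraic over $\mathbb{C}((x))$. Then $\xi$ is a Laurent series $$\xi = \sum_{\alpha \in \mathbb{Z}^n} \xi_\alpha x^\alpha, \qquad \xi_\alpha \in \mathbb{C}$$ (an unconditionally convergent sum in $\widehat{\mathbb{C}((x))}^{\omega}$), and there are $\gamma \in \mathbb{Z}^n$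 and a rational strongly convex polyhedral cone $\sigma \subset \mathbb{R}^n$ such that $$\operatorname{Supp}(\xi) := \{\alpha \in \mathbb{Z}^n \mid \xi_\alpha \neq 0\} \subset \gamma + \sigma .$$ Here a rational strongly convex polyhedral cone is a set $\sigma = \{\lambda_1 s_1 + \dots + \lambda_r s_r \mid \lambda_i \in \mathbb{R}_{\geq 0}\}$ with $s_1, \dots, s_r \in \mathbb{Z}^n$ that does not contain a line. -/

import Mathlib

open scoped NNReal

namespace MacDonald

/-- The weight `⟨ω, α⟩ = ∑ i, ω i * α i` of an exponent `α ∈ ℕⁿ`. -/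
noncomputable def weight {n : ℕ} (ω : Fin n → ℝ) (α : Fin n →₀ ℕ) : ℝ :=
  ∑ i, ω i * (α i : ℝ)

/-- The set of weights `⟨ω, α⟩` of the exponents `α` of the monomials of `f`. -/
def weights {n : ℕ} (ω : Fin n → ℝ) (f : MvPowerSeries (Fin n) ℂ) : Set ℝ :=
  {r | ∃ α : Fin n →₀ ℕ, MvPowerSeries.coeff α f ≠ 0 ∧ weight ω α = r}

/-- The `ω`-order `ν_ω(f) = min {⟨ω, α⟩ | f_α ≠ 0}`, for `f ≠ 0`
(the infimum is attained when all `ω i > 0`, see `exists_coeff_ne_zero_of_ne_zero`). -/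
noncomputable def order {n : ℕ} (ω : Fin n → ℝ) (f : MvPowerSeries (Fin n) ℂ) : ℝ :=
  sInf (weights ω f)

open scoped Classical in
/-- The norm `|f|_ω = exp (-ν_ω(f))`, with `|0|_ω = 0`. -/
noncomputable def norm {n : ℕ} (ω : Fin n → ℝ) (f : MvPowerSeries (Fin n) ℂ) : ℝ≥0 :=
  if f = 0 then 0 else Real.toNNReal (Real.exp (-order ω f))

variable {n : ℕ} {ω : Fin n → ℝ}

theorem weight_add (α β : Fin n →₀ ℕ) : weight ω (α + β) = weight ω α + weight ω β := by
  simp [weight, mul_add, Finset.sum_add_distrib]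

theorem weight_nonneg (hω : ∀ i, 0 < ω i) (α : Fin n →₀ ℕ) : 0 ≤ weight ω α :=
  Finset.sum_nonneg fun i _ => mul_nonneg (hω i).le (Nat.cast_nonneg _)

theorem finite_weight_le (hω : ∀ i, 0 < ω i) (r : ℝ) :
    {α : Fin n →₀ ℕ | weight ω α ≤ r}.Finite := by
  refine (Set.finite_Iic (Finsupp.equivFunOnFinite.symm fun i => ⌊r / ω i⌋₊)).subset ?_
  intro α hα i
  have h1 : ω i * (α i : ℝ) ≤ r :=
    le_trans (Finset.single_le_sum (f := fun i => ω i * (α i : ℝ))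
      (fun j _ => mul_nonneg (hω j).le (Nat.cast_nonneg _)) (Finset.mem_univ i)) hα
  have h2 : (α i : ℝ) ≤ r / ω i := by
    rw [le_div_iff₀ (hω i)]; linarith
  simpa using Nat.le_floor h2

theorem order_le (hω : ∀ i, 0 < ω i) {f : MvPowerSeries (Fin n) ℂ} {α : Fin n →₀ ℕ}
    (h : MvPowerSeries.coeff α f ≠ 0) : order ω f ≤ weight ω α :=
  csInf_le ⟨0, by rintro _ ⟨β, -, rfl⟩; exact weight_nonneg hω β⟩ ⟨α, h, rfl⟩

theorem exists_coeff_ne_zero_of_ne_zero (hω : ∀ i, 0 < ω i) {f : MvPowerSeries (Fin n) ℂ}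
    (hf : f ≠ 0) : ∃ α, MvPowerSeries.coeff α f ≠ 0 ∧ weight ω α = order ω f := by
  obtain ⟨β, hβ⟩ : ∃ β, MvPowerSeries.coeff β f ≠ 0 := by
    by_contra! h
    exact hf (MvPowerSeries.ext fun β => by simpa using h β)
  have hfin : {α | MvPowerSeries.coeff α f ≠ 0 ∧ weight ω α ≤ weight ω β}.Finite :=
    (finite_weight_le hω (weight ω β)).subset fun α h => h.2
  obtain ⟨α, hα, hmin⟩ := Set.exists_min_image _ (weight ω) hfin ⟨β, hβ, le_rfl⟩
  refine ⟨α, hα.1, le_antisymm (le_csInf ⟨_, β, hβ, rfl⟩ ?_) (order_le hω hα.1)⟩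
  rintro _ ⟨δ, hδ, rfl⟩
  rcases le_total (weight ω δ) (weight ω β) with h | h
  · exact hmin δ ⟨hδ, h⟩
  · exact hα.2.trans h

theorem order_one (hω : ∀ i, 0 < ω i) : order ω (1 : MvPowerSeries (Fin n) ℂ) = 0 := by
  classical
  obtain ⟨α, hα, h⟩ := exists_coeff_ne_zero_of_ne_zero hω (one_ne_zero (α := MvPowerSeries (Fin n) ℂ))
  rw [MvPowerSeries.coeff_one] at hα
  have : α = 0 := by by_contra h0; simp [h0] at hα
  rw [← h, this]; simp [weight]

theorem min_order_le_add (hω : ∀ i, 0 < ω i) {f g : MvPowerSeries (Fin n) ℂ} (h : f + g ≠ 0) :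
    (f ≠ 0 ∧ order ω f ≤ order ω (f + g)) ∨ (g ≠ 0 ∧ order ω g ≤ order ω (f + g)) := by
  obtain ⟨α, hα, e⟩ := exists_coeff_ne_zero_of_ne_zero hω h
  rw [← e]
  by_cases hf : MvPowerSeries.coeff α f = 0
  · have hg : MvPowerSeries.coeff α g ≠ 0 := by simpa [hf] using hα
    exact Or.inr ⟨fun h0 => hg (by simp [h0]), order_le hω hg⟩
  · exact Or.inl ⟨fun h0 => hf (by simp [h0]), order_le hω hf⟩

theorem order_mul (hω : ∀ i, 0 < ω i) {f g : MvPowerSeries (Fin n) ℂ} (hf : f ≠ 0) (hg : g ≠ 0) :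
    order ω (f * g) = order ω f + order ω g := by
  classical
  have key : ∀ f : MvPowerSeries (Fin n) ℂ,
      {α | MvPowerSeries.coeff α f ≠ 0 ∧ weight ω α = order ω f}.Finite := fun f =>
    (finite_weight_le hω (order ω f)).subset fun α h => h.2.le
  obtain ⟨a, ha, b, hb, hu⟩ := UniqueSums.uniqueAdd_of_nonempty
    (A := (key f).toFinset) (B := (key g).toFinset)
    (by simpa [Set.Nonempty] using exists_coeff_ne_zero_of_ne_zero hω hf)
    (by simpa [Set.Nonempty] using exists_coeff_ne_zero_of_ne_zero hω hg)
  simp only [Set.Finite.mem_toFinset, Set.mem_ofPred_eq] at ha hb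
  have hab : MvPowerSeries.coeff (a + b) (f * g) ≠ 0 := by
    rw [MvPowerSeries.coeff_mul, Finset.sum_eq_single (a, b)]
    · exact mul_ne_zero ha.1 hb.1
    · rintro ⟨c, d⟩ hcd hne
      by_contra h0
      have hc := left_ne_zero_of_mul h0
      have hd := right_ne_zero_of_mul h0
      rw [Finset.HasAntidiagonal.mem_antidiagonal] at hcd
      have hw : weight ω c + weight ω d = order ω f + order ω g := by
        rw [← ha.2, ← hb.2, ← weight_add, ← weight_add, hcd]
      have h1 := order_le hω hc
      have h2 := order_le hω hd
      simp only at h1 h2 hc hd hcd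
      have := hu (a := c) (b := d) (by simpa using ⟨hc, by linarith⟩)
        (by simpa using ⟨hd, by linarith⟩) hcd
      exact hne (Prod.ext this.1 this.2)
    · intro h; simp at h
  refine le_antisymm ?_ (le_csInf ⟨_, a + b, hab, rfl⟩ ?_)
  · rw [← ha.2, ← hb.2, ← weight_add]; exact order_le hω hab
  · rintro _ ⟨δ, hδ, rfl⟩
    rw [MvPowerSeries.coeff_mul] at hδ
    obtain ⟨⟨c, d⟩, hcd, h0⟩ := Finset.exists_ne_zero_of_sum_ne_zero hδ
    rw [Finset.HasAntidiagonal.mem_antidiagonal] at hcd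
    rw [← hcd, weight_add]
    exact add_le_add (order_le hω (left_ne_zero_of_mul h0)) (order_le hω (right_ne_zero_of_mul h0))

/-- The norm `|·|_ω` on `ℂ⟦x₁, …, xₙ⟧` as a (multiplicatively written) valuation. -/
noncomputable def powerSeriesValuation (ω : Fin n → ℝ) (hω : ∀ i, 0 < ω i) :
    Valuation (MvPowerSeries (Fin n) ℂ) ℝ≥0 where
  toFun := norm ω
  map_zero' := by simp [norm]
  map_one' := by simp [norm, order_one hω]
  map_mul' f g := by
    by_cases hf : f = 0
    · simp [norm, hf]
    by_cases hg : g = 0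
    · simp [norm, hg]
    rw [norm, norm, norm, if_neg hf, if_neg hg, if_neg (mul_ne_zero hf hg), order_mul hω hf hg,
      ← Real.toNNReal_mul (Real.exp_nonneg _), ← Real.exp_add]
    congr 2; ring
  map_add_le_max' f g := by
    by_cases h : f + g = 0
    · simp [norm, h]
    have mono : ∀ k : MvPowerSeries (Fin n) ℂ, k ≠ 0 → order ω k ≤ order ω (f + g) →
        norm ω (f + g) ≤ norm ω k := by
      intro k hk hle
      rw [norm, norm, if_neg h, if_neg hk]
      exact Real.toNNReal_le_toNNReal (Real.exp_le_exp.2 (by linarith))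
    rcases min_order_le_add hω h with ⟨hk, hle⟩ | ⟨hk, hle⟩
    · exact le_max_of_le_left (mono _ hk hle)
    · exact le_max_of_le_right (mono _ hk hle)

theorem nonZeroDivisors_le_primeCompl (ω : Fin n → ℝ) (hω : ∀ i, 0 < ω i) :
    nonZeroDivisors (MvPowerSeries (Fin n) ℂ) ≤ (powerSeriesValuation ω hω).supp.primeCompl := by
  intro f hf h
  have hf0 : f ≠ 0 := nonZeroDivisors.ne_zero hf
  have h' : norm ω f = 0 := h
  rw [norm, if_neg hf0, Real.toNNReal_eq_zero] at h'
  exact absurd h' (not_le.2 (Real.exp_pos _))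

/-- `ℂ((x))`, the fraction field of the ring `ℂ⟦x₁, …, xₙ⟧` of formal power series. -/
def LaurentField (n : ℕ) : Type := FractionRing (MvPowerSeries (Fin n) ℂ)

noncomputable instance : Field (LaurentField n) :=
  inferInstanceAs (Field (FractionRing (MvPowerSeries (Fin n) ℂ)))

noncomputable instance : Algebra (MvPowerSeries (Fin n) ℂ) (LaurentField n) :=
  inferInstanceAs (Algebra (MvPowerSeries (Fin n) ℂ) (FractionRing (MvPowerSeries (Fin n) ℂ)))

instance : IsFractionRing (MvPowerSeries (Fin n) ℂ) (LaurentField n) :=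
  inferInstanceAs
    (IsFractionRing (MvPowerSeries (Fin n) ℂ) (FractionRing (MvPowerSeries (Fin n) ℂ)))

/-- The norm `|f / g|_ω = exp (-(ν_ω(f) - ν_ω(g)))` on `ℂ((x))`, as a valuation. -/
noncomputable def valuation (ω : Fin n → ℝ) (hω : ∀ i, 0 < ω i) :
    Valuation (LaurentField n) ℝ≥0 :=
  (powerSeriesValuation ω hω).extendToLocalization (nonZeroDivisors_le_primeCompl ω hω)
    (LaurentField n)

/-- `ℂ((x))` endowed with the topology defined by `|·|_ω`. As a field, it is a copy
of `LaurentField n`, through `WithVal.toVal` and `WithVal.ofVal`. -/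
abbrev ValuedLaurentField (ω : Fin n → ℝ) (hω : ∀ i, 0 < ω i) : Type :=
  WithVal (valuation ω hω)

/-- The completion of `ℂ((x))` with respect to `|·|_ω`. -/
abbrev WCompletion (ω : Fin n → ℝ) (hω : ∀ i, 0 < ω i) : Type :=
  UniformSpace.Completion (ValuedLaurentField ω hω)

/-- The canonical embedding of `ℂ((x))` in its completion with respect to `|·|_ω`. -/
noncomputable def toCompletion (ω : Fin n → ℝ) (hω : ∀ i, 0 < ω i) (h : LaurentField n) :
    WCompletion ω hω :=
  algebraMap (ValuedLaurentField ω hω) (WCompletion ω hω) (WithVal.toVal (valuation ω hω) h)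

/-- The Laurent monomial `x^α = x₁^α₁ ⋯ xₙ^αₙ ∈ ℂ((x))`, for `α ∈ ℤⁿ`. -/
noncomputable def laurentMonomial (α : Fin n → ℤ) : LaurentField n :=
  ∏ i, algebraMap (MvPowerSeries (Fin n) ℂ) (LaurentField n) (MvPowerSeries.X i) ^ α i

/-- The term `c x^α ∈ ℂ((x))`, for `c ∈ ℂ` and `α ∈ ℤⁿ`. -/
noncomputable def laurentTerm (c : ℂ) (α : Fin n → ℤ) : LaurentField n :=
  algebraMap (MvPowerSeries (Fin n) ℂ) (LaurentField n) (MvPowerSeries.C c) * laurentMonomial α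

/-- `ξ = ∑_{α ∈ ℤⁿ} c_α x^α`, as an unconditionally convergent sum in the completion. -/
def IsLaurentExpansion (ω : Fin n → ℝ) (hω : ∀ i, 0 < ω i) (c : (Fin n → ℤ) → ℂ)
    (ξ : WCompletion ω hω) : Prop :=
  HasSum (fun α : Fin n → ℤ => toCompletion ω hω (laurentTerm (c α) α)) ξ

/-- The inclusion `ℤⁿ ⊆ ℝⁿ`. -/
def toReal (α : Fin n → ℤ) : Fin n → ℝ := fun i => (α i : ℝ)

/-- `σ` is a rational polyhedral cone: it is the set of all linear combinations with nonnegative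
real coefficients of finitely many vectors of `ℤⁿ`. -/
def IsRationalPolyhedral (σ : PointedCone ℝ (Fin n → ℝ)) : Prop :=
  ∃ S : Finset (Fin n → ℤ), σ = PointedCone.hull ℝ (toReal '' (S : Set (Fin n → ℤ)))

/-- `σ` is strongly convex: it does not contain a line. -/
def IsStronglyConvex (σ : PointedCone ℝ (Fin n → ℝ)) : Prop :=
  ¬ ∃ p v : Fin n → ℝ, v ≠ 0 ∧ ∀ t : ℝ, p + t • v ∈ σ

end MacDonald

/-!
Every algebraic element of the completion is a monomial times a limit of Laurent polynomials
whose exponents lie in a fixed monoid generated by finitely many vectors of positive weight; such a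
monoid spans a strongly convex rational cone. Everything takes place inside the completion: instead
of rings of series with support in a cone, the proof uses the closed subring `generatedSubring S`
topologically generated by the terms with exponents in the monoid generated by a finite set `S`.

* Closed subrings contain the fixed points of contractions (`mem_of_eval_eq_self`): if `Q` has
  coefficients of norm `< 1` in a closed subring and `Q(η) = η` with `|η| ≤ 1`, then `η` is the limit
  of the iterates of `Q` at `0` and lies in the subring. In particular `1 + u` with `|u| < 1` is
  invertible there.
* By independence of the `ωᵢ`, a nonzero power series has a single initial term. Together with
  a finiteness property of translates of `ℕⁿ` (`exists_generators`) and the inversion of `1 + u`, this shows that every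
  nonzero element of `ℂ((x))` is `c x^γ (1 + w)` with `|w| < 1` and `w` in some `generatedSubring S`,
  all elements of `S` having positive weight (`algebraMap_eq_term_mul`).
* If `ξ ∉ ℂ((x))` is algebraic, expand its minimal polynomial, which is separable, at a close
  approximation `a ∈ ℂ((x))`. As in Hensel's lemma, `ξ = a + b η` where `b ∈ ℂ((x))`, `|b| < |a|`, and
  `η` is a fixed point of a polynomial over `ℂ((x))` with coefficients of norm `< 1`
  (`exists_eq_add_mul_fixedPoint`). The finitely many coefficients, `b / a`, and the `1`-unit attached
  to `a` lie in a common `generatedSubring S`, hence so does `η`, and so does `ξ` up to a monomial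
  (`exists_eq_term_mul_of_isAlgebraic`).
* A limit of Laurent polynomials with exponents in a set `T` is the sum of a Laurent series with
  exponents in `T` (`exists_laurentExpansion`), since the coefficients of close Laurent polynomials
  agree up to high weight.
-/

namespace MacDonald

/-! ### Fixed points and approximation in valued fields -/

section ValuedField

open Polynomial Filter Topology

variable {L : Type*} [Field L] [Valued L ℝ≥0]

theorem ball_mem_nhds_zero {c : L} (hc : c ≠ 0) : {x : L | Valued.v x < Valued.v c} ∈ 𝓝 (0 : L) := by
  rw [Valued.mem_nhds_zero]
  refine ⟨Units.mk0 (Valued.v.restrict c) (by simpa using hc), fun x hx => ?_⟩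
  exact Valued.v.restrict_lt_iff.mp hx

/-- Neighbourhoods are described by radii which are values of the valuation: when the valuation is
trivial, as for `n = 0`, the radii `< 1` are not such values. -/
theorem exists_ball_subset {s : Set L} {x : L} (hs : s ∈ 𝓝 x) :
    ∃ c : L, c ≠ 0 ∧ ∀ y, Valued.v (y - x) < Valued.v c → y ∈ s := by
  obtain ⟨γ, hγ⟩ := Valued.mem_nhds.1 hs
  obtain ⟨c, hc⟩ : ∃ c : L, Valued.v.restrict c = γ.1 :=
    MonoidWithZeroHom.ValueGroup₀.restrict₀_surjective (.ofClass (Valued.v (R := L))) γ.1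
  refine ⟨c, ?_, fun y hy => hγ ?_⟩
  · rintro rfl
    simp at hc
    exact γ.ne_zero hc.symm
  · change Valued.v.restrict (y - x) < γ.1
    rw [← hc]
    exact Valued.v.restrict_lt_iff.mpr hy

theorem eventually_valuation_lt {f : L → L} {x c : L} (hf : ContinuousAt f x) (h0 : f x = 0)
    (hc : c ≠ 0) : ∀ᶠ y in 𝓝 x, Valued.v (f y) < Valued.v c := by
  have := hf.tendsto
  rw [h0] at this
  exact this (ball_mem_nhds_zero hc)

theorem valuation_pow_sub_pow_le {y z : L} (hy : Valued.v y ≤ 1) (hz : Valued.v z ≤ 1) (k : ℕ) :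
    Valued.v (y ^ k - z ^ k) ≤ Valued.v (y - z) := by
  induction k with
  | zero => simp
  | succ k ih =>
    have e : y ^ (k + 1) - z ^ (k + 1) = y ^ k * (y - z) + (y ^ k - z ^ k) * z := by ring
    rw [e]
    refine (Valued.v.map_add _ _).trans (max_le ?_ ?_)
    · rw [map_mul, map_pow]
      exact mul_le_of_le_one_left' (pow_le_one' hy k)
    · rw [map_mul]
      exact (mul_le_of_le_one_right' hz).trans ih

theorem valuation_eval_sub_eval_le {Q : L[X]} {ρ : ℝ≥0} (hQ : ∀ k, Valued.v (Q.coeff k) ≤ ρ)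
    {y z : L} (hy : Valued.v y ≤ 1) (hz : Valued.v z ≤ 1) :
    Valued.v (Q.eval y - Q.eval z) ≤ ρ * Valued.v (y - z) := by
  rw [eval_eq_sum_range, eval_eq_sum_range, ← Finset.sum_sub_distrib]
  refine Valued.v.map_sum_le fun k _ => ?_
  rw [← mul_sub, map_mul]
  exact mul_le_mul' (hQ k) (valuation_pow_sub_pow_le hy hz k)

/-- A polynomial whose coefficients have norm `< 1` is a contraction of the unit ball, so that its
fixed point is a limit of iterates and lies in every closed subring containing the coefficients. -/
theorem mem_of_eval_eq_self {R : Subring L} (hR : IsClosed (R : Set L)) {Q : L[X]}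
    (hQR : ∀ k, Q.coeff k ∈ R) (hQ : ∀ k, Valued.v (Q.coeff k) < 1) {η : L}
    (hη : Valued.v η ≤ 1) (hfix : Q.eval η = η) : η ∈ R := by
  obtain ⟨ρ, hρ, hQρ⟩ : ∃ ρ : ℝ≥0, ρ < 1 ∧ ∀ k, Valued.v (Q.coeff k) ≤ ρ := by
    refine ⟨Q.support.sup fun k => Valued.v (Q.coeff k),
      (Finset.sup_lt_iff (by simp)).2 fun k _ => hQ k, fun k => ?_⟩
    by_cases hk : k ∈ Q.support
    · exact Finset.le_sup (f := fun k => Valued.v (Q.coeff k)) hk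
    · simp [notMem_support_iff.1 hk]
  let Y : ℕ → L := fun m => (fun y => Q.eval y)^[m] 0
  have hYs : ∀ m, Y (m + 1) = Q.eval (Y m) := fun m => Function.iterate_succ_apply' _ _ _
  have hYR : ∀ m, Y m ∈ R := by
    intro m
    induction m with
    | zero => exact R.zero_mem
    | succ m ih =>
      rw [hYs, eval_eq_sum_range]
      exact R.sum_mem fun k _ => R.mul_mem (hQR k) (R.pow_mem ih k)
  have hY1 : ∀ m, Valued.v (Y m) ≤ 1 := by
    intro m
    induction m with
    | zero => simp [Y]
    | succ m ih =>
      rw [hYs, eval_eq_sum_range]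
      refine Valued.v.map_sum_le fun k _ => ?_
      rw [map_mul, map_pow]
      exact mul_le_one' (hQ k).le (pow_le_one' ih k)
  have hlim : ∀ m, Valued.v (Y m - η) ≤ ρ ^ m := by
    intro m
    induction m with
    | zero => simpa [Y] using hη
    | succ m ih =>
      rw [hYs]
      conv_lhs => rw [← hfix]
      refine (valuation_eval_sub_eval_le hQρ (hY1 m) hη).trans ?_
      rw [pow_succ']
      exact mul_le_mul' le_rfl ih
  refine hR.closure_subset (mem_closure_iff_nhds.2 fun s hs => ?_)
  obtain ⟨c, hc, hcs⟩ := exists_ball_subset hs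
  obtain ⟨m, hm⟩ := exists_pow_lt_of_lt_one
    (pos_iff_ne_zero.2 ((Valuation.ne_zero_iff Valued.v).2 hc)) hρ
  exact ⟨Y m, hcs _ ((hlim m).trans_lt hm), hYR m⟩

theorem valuation_one_add {u : L} (hu : Valued.v u < 1) : Valued.v (1 + u) = 1 :=
  Valued.v.map_one_add_of_lt hu

theorem one_add_ne_zero {u : L} (hu : Valued.v u < 1) : 1 + u ≠ 0 := by
  rw [← Valuation.ne_zero_iff Valued.v, valuation_one_add hu]
  exact one_ne_zero

theorem inv_one_add_mem {R : Subring L} (hR : IsClosed (R : Set L)) {u : L} (huR : u ∈ R)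
    (hu : Valued.v u < 1) : (1 + u)⁻¹ ∈ R := by
  have h0 := one_add_ne_zero hu
  -- `(1 + u)⁻¹ = 1 + y`, where `y` is the fixed point of `-u - u X`.
  have hy : (1 + u)⁻¹ - 1 ∈ R := by
    have hcoeff : ∀ k, (-(C u) - C u * X : L[X]).coeff k = 0 ∨
        (-(C u) - C u * X : L[X]).coeff k = -u := by
      intro k
      rcases k with _ | _ | k <;> simp [coeff_C, coeff_X]
    refine mem_of_eval_eq_self hR (Q := -(C u) - C u * X) (fun k => ?_) (fun k => ?_) ?_ ?_
    · rcases hcoeff k with h | h <;> rw [h]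
      exacts [R.zero_mem, R.neg_mem huR]
    · rcases hcoeff k with h | h <;> rw [h]
      · simp
      · rwa [Valuation.map_neg]
    · have e : (1 + u)⁻¹ - 1 = -u * (1 + u)⁻¹ := by field_simp; ring
      rw [e, map_mul, map_inv₀, valuation_one_add hu, Valuation.map_neg]
      simpa using hu.le
    · simp
      field_simp
      ring
  simpa using R.add_mem hy R.one_mem

/-- Newton's approximation: an algebraic element `ξ` of the closure of `K`, which is not in `K`, is
up to an affine change of variable over `K` the fixed point of a polynomial over `K` with
coefficients of norm `< 1`. -/
theorem exists_eq_add_mul_fixedPoint {K : Type*} [Field K] [CharZero K] [Algebra K L]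
    (hd : DenseRange (algebraMap K L)) {ξ : L} (hξ : IsAlgebraic K ξ)
    (hξK : ξ ∉ Set.range (algebraMap K L)) :
    ∃ (a b : K) (η : L) (Q : K[X]), ξ = algebraMap K L a + algebraMap K L b * η ∧ a ≠ 0 ∧
      Valued.v (algebraMap K L b) < Valued.v (algebraMap K L a) ∧ Valued.v η < 1 ∧
      (∀ k, Valued.v (algebraMap K L (Q.coeff k)) < 1) ∧ aeval η Q = η := by
  set P := minpoly K ξ with hP
  have hsep : P.Separable := (minpoly.irreducible hξ.isIntegral).separable
  have hPξ : aeval ξ P = 0 := minpoly.aeval K ξ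
  have hd0 : aeval ξ (derivative P) ≠ 0 := hsep.aeval_derivative_ne_zero hPξ
  have hξ0 : ξ ≠ 0 := fun h => hξK ⟨0, by simp [h]⟩
  have exK : ∀ p : L → Prop, (∀ᶠ y in 𝓝 ξ, p y) → ∃ a : K, p (algebraMap K L a) := by
    intro p hp
    obtain ⟨_, h, a, rfl⟩ := mem_closure_iff_nhds.1 (hd ξ) _ hp
    exact ⟨a, h⟩
  have hsub : ContinuousAt (fun y : L => y - ξ) ξ := by fun_prop
  -- The scale: `b` will be a difference of two approximations, of the norm of `a₀ - ξ`.
  obtain ⟨a₀, ha₀ξ, ha₀1, ha₀d, ha₀H⟩ := exK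
    (fun y => Valued.v (y - ξ) < Valued.v ξ ∧ Valued.v (y - ξ) < Valued.v (1 : L) ∧
      Valued.v (y - ξ) < Valued.v (aeval ξ (derivative P)) ∧
      ∀ k ∈ Finset.range (P.natDegree + 1),
        Valued.v ((y - ξ) * aeval ξ (hasseDeriv k P)) < Valued.v (aeval ξ (derivative P))) (by
    refine (eventually_valuation_lt hsub (by simp) hξ0).and
      ((eventually_valuation_lt hsub (by simp) one_ne_zero).and
      ((eventually_valuation_lt hsub (by simp) hd0).and
      ((Filter.eventually_all_finset _).2 fun k _ =>
        eventually_valuation_lt (by fun_prop) (by simp) hd0)))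
    )
  have ha₀0 : algebraMap K L a₀ - ξ ≠ 0 := fun h => hξK ⟨a₀, sub_eq_zero.1 h⟩
  -- A closer approximation, at which the derivative and the Taylor coefficients are controlled.
  obtain ⟨a, haξ, had, haH⟩ := exK
    (fun y => Valued.v (y - ξ) < Valued.v (algebraMap K L a₀ - ξ) ∧
      Valued.v (aeval y (derivative P)) = Valued.v (aeval ξ (derivative P)) ∧
      ∀ k ∈ Finset.range (P.natDegree + 1),
        Valued.v (aeval y (hasseDeriv k P) - aeval ξ (hasseDeriv k P)) < Valued.v (1 : L)) (by
    refine (eventually_valuation_lt hsub (by simp) ha₀0).and (.and ?_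
      ((Filter.eventually_all_finset _).2 fun k _ =>
        eventually_valuation_lt ?_ (by simp) one_ne_zero))
    · exact (derivative P).continuous_aeval.continuousAt
        (Valued.locally_const ((Valuation.ne_zero_iff _).2 hd0))
    · exact ((hasseDeriv k P).continuous_aeval.sub continuous_const).continuousAt)
  set A := algebraMap K L a with hA
  have hb : Valued.v (algebraMap K L (a₀ - a)) = Valued.v (algebraMap K L a₀ - ξ) := by
    have e : algebraMap K L (a₀ - a) = (algebraMap K L a₀ - ξ) - (A - ξ) := by
      rw [map_sub]; ring
    rw [e]
    exact Valuation.map_sub_eq_of_lt_left _ haξ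
  set b := a₀ - a with hbdef
  set B := algebraMap K L b with hB
  have hB0 : B ≠ 0 := by
    rw [← Valuation.ne_zero_iff Valued.v, hb]
    exact (Valuation.ne_zero_iff _).2 ha₀0
  have hvA : Valued.v A = Valued.v ξ :=
    Valuation.map_eq_of_sub_lt _ (haξ.trans ha₀ξ)
  have hA0 : A ≠ 0 := by
    rw [← Valuation.ne_zero_iff Valued.v, hvA]
    exact (Valuation.ne_zero_iff _).2 hξ0
  have hdA0 : aeval A (derivative P) ≠ 0 := by
    rw [← Valuation.ne_zero_iff Valued.v, had]
    exact (Valuation.ne_zero_iff _).2 hd0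
  have hda : algebraMap K L ((derivative P).eval a) = aeval A (derivative P) := by
    rw [hA, aeval_algebraMap_apply_eq_algebraMap_eval]
  have hda0 : (derivative P).eval a ≠ 0 := fun h => hdA0 (by rw [← hda, h, map_zero])
  have hb0 : b ≠ 0 := fun h => hB0 (by rw [hB, h, map_zero])
  -- `η` is a root of `P (a + b X) / (P' (a) b)`, whose linear coefficient is `1`.
  let Q : K[X] := X - C (((derivative P).eval a * b)⁻¹) * (taylor a P).comp (C b * X)
  let η : L := (ξ - A) / B
  have hη : Valued.v η < 1 := by
    rw [map_div₀, hb, Valuation.map_sub_swap]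
    exact (div_lt_one₀ (pos_iff_ne_zero.2 ((Valuation.ne_zero_iff _).2 ha₀0))).2 haξ
  have hξη : ξ = A + B * η := by
    simp only [η]; field_simp; ring
  have hfix : aeval η Q = η := by
    have : aeval η ((taylor a P).comp (C b * X)) = 0 := by
      rw [aeval_comp, taylor_apply, aeval_comp]
      simp only [map_add, map_mul, aeval_X, aeval_C]
      rw [show algebraMap K L b * η + algebraMap K L a = ξ by rw [hξη]; ring, hPξ]
    simp only [Q, map_sub, map_mul, this, aeval_X, mul_zero, sub_zero]
  have hcoeff : ∀ k, k ≠ 0 → Valued.v (algebraMap K L (Q.coeff k)) < 1 := by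
    intro k hk
    simp only [Q, coeff_sub, coeff_C_mul, comp_C_mul_X_coeff, taylor_coeff]
    rcases Nat.lt_or_ge k 2 with h | h
    · obtain rfl : k = 1 := by omega
      have : (1 : K) - ((derivative P).eval a * b)⁻¹ * ((derivative P).eval a * b) = 0 := by
        rw [inv_mul_cancel₀ (mul_ne_zero hda0 hb0), sub_self]
      rw [hasseDeriv_one, coeff_X_one, pow_one, this]
      simp
    · rcases Nat.lt_or_ge P.natDegree k with hkd | hkd
      · rw [hasseDeriv_eq_zero_of_lt_natDegree _ _ hkd]
        simp [coeff_X, (show 1 ≠ k by omega)]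
      · have hk' : k ∈ Finset.range (P.natDegree + 1) := Finset.mem_range.2 (by omega)
        have hH : algebraMap K L ((hasseDeriv k P).eval a) = aeval A (hasseDeriv k P) := by
          rw [hA, aeval_algebraMap_apply_eq_algebraMap_eval]
        obtain ⟨j, rfl⟩ : ∃ j, k = j + 2 := ⟨k - 2, by omega⟩
        have e : X.coeff (j + 2) - ((derivative P).eval a * b)⁻¹ *
            ((hasseDeriv (j + 2) P).eval a * b ^ (j + 2)) =
            -(((derivative P).eval a)⁻¹ * (b * (hasseDeriv (j + 2) P).eval a) * b ^ j) := by
          simp only [coeff_X, show 1 ≠ j + 2 by omega, if_false]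
          field_simp
          ring
        rw [e, map_neg, Valuation.map_neg]
        simp only [map_mul, map_inv₀, map_pow, hda, hH]
        rw [← hB, had, hb]
        have h1 : Valued.v (algebraMap K L a₀ - ξ) * Valued.v (aeval A (hasseDeriv (j + 2) P)) <
            Valued.v (aeval ξ (derivative P)) := by
          have h2 : Valued.v (aeval A (hasseDeriv (j + 2) P)) ≤
              max (Valued.v (1 : L)) (Valued.v (aeval ξ (hasseDeriv (j + 2) P))) := by
            have := Valued.v.map_add (aeval A (hasseDeriv (j + 2) P) -
              aeval ξ (hasseDeriv (j + 2) P)) (aeval ξ (hasseDeriv (j + 2) P))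
            rw [sub_add_cancel] at this
            exact this.trans (max_le_max (haH _ hk').le le_rfl)
          refine (mul_le_mul' le_rfl h2).trans_lt ?_
          rcases max_choice (Valued.v (1 : L)) (Valued.v (aeval ξ (hasseDeriv (j + 2) P))) with
            h3 | h3 <;> rw [h3]
          · simpa using ha₀d
          · simpa using ha₀H _ hk'
        have hpos := pos_iff_ne_zero.2 ((Valuation.ne_zero_iff Valued.v).2 hd0)
        refine (mul_le_of_le_one_right' (pow_le_one' (by simpa using ha₀1.le) j)).trans_lt ?_
        rw [inv_mul_lt_one₀ hpos]
        exact h1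
  refine ⟨a, b, η, Q, hξη, fun h => hA0 (by rw [hA, h, map_zero]), ?_, hη, fun k => ?_, hfix⟩
  · rw [← hA, ← hB, hb, hvA]
    exact ha₀ξ
  · rcases eq_or_ne k 0 with rfl | hk
    · -- The constant coefficient is small because all the other terms of `Q η = η` are.
      have e := hfix
      rw [aeval_eq_sum_range, Finset.sum_range_succ'] at e
      have e' : algebraMap K L (Q.coeff 0) = η -
          ∑ k ∈ Finset.range Q.natDegree, Q.coeff (k + 1) • η ^ (k + 1) := by
        rw [eq_sub_iff_add_eq, add_comm]
        simpa [Algebra.smul_def] using e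
      rw [e']
      refine (Valued.v.map_sub _ _).trans_lt (max_lt hη ?_)
      refine Valued.v.map_sum_lt one_ne_zero fun k _ => ?_
      rw [Algebra.smul_def, map_mul, map_pow]
      exact (mul_le_of_le_one_right' (pow_le_one' hη.le _)).trans_lt (hcoeff _ (by omega))
    · exact hcoeff k hk

end ValuedField

/-! ### Laurent terms in the completion -/

section Terms

open Filter Topology

variable {n : ℕ} {ω : Fin n → ℝ} {hω : ∀ i, 0 < ω i}

/-- The weight `⟨ω, α⟩` of an integral exponent `α ∈ ℤⁿ`. -/
noncomputable def intWeight (ω : Fin n → ℝ) (α : Fin n → ℤ) : ℝ :=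
  ∑ i, ω i * (α i : ℝ)

theorem intWeight_sub (α β : Fin n → ℤ) :
    intWeight ω (α - β) = intWeight ω α - intWeight ω β := by
  simp [intWeight, mul_sub, Finset.sum_sub_distrib]

/-- The weights of distinct exponents are distinct, by the independence of the `ω i`. -/
theorem intWeight_injective (hlin : LinearIndependent ℚ ω) :
    Function.Injective (intWeight ω) := by
  intro α β h
  have h0 : ∑ i, ((α i - β i : ℤ) : ℚ) • ω i = 0 := by
    rw [← sub_eq_zero, ← intWeight_sub] at h
    rw [← h, intWeight]
    refine Finset.sum_congr rfl fun i _ => ?_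
    rw [Rat.smul_def, mul_comm]
    simp
  funext i
  have := Fintype.linearIndependent_iff.1 hlin _ h0 i
  exact sub_eq_zero.1 (by exact_mod_cast this)

/-- An exponent of `ℕⁿ`, seen in `ℤⁿ`. -/
def natExponent (α : Fin n →₀ ℕ) : Fin n → ℤ := fun i => (α i : ℤ)

theorem intWeight_natExponent (α : Fin n →₀ ℕ) : intWeight ω (natExponent α) = weight ω α := by
  simp [intWeight, weight, natExponent]

theorem natExponent_injective : Function.Injective (natExponent (n := n)) := by
  intro α β h
  ext i
  exact Int.ofNat_injective (congrFun h i)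

/-- `toCompletion` as a ring homomorphism. -/
noncomputable def toCompletionHom (ω : Fin n → ℝ) (hω : ∀ i, 0 < ω i) :
    LaurentField n →+* WCompletion ω hω :=
  (algebraMap (ValuedLaurentField ω hω) (WCompletion ω hω)).comp
    (WithVal.equiv (valuation ω hω)).symm.toRingHom

theorem toCompletionHom_apply (h : LaurentField n) :
    toCompletionHom ω hω h = toCompletion ω hω h := rfl

/-- The embedding of `ℂ⟦x₁, …, xₙ⟧` in the completion. -/
noncomputable def ofPowerSeries (ω : Fin n → ℝ) (hω : ∀ i, 0 < ω i) :
    MvPowerSeries (Fin n) ℂ →+* WCompletion ω hω :=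
  (toCompletionHom ω hω).comp (algebraMap _ (LaurentField n))

theorem valuation_algebraMap (x : ValuedLaurentField ω hω) :
    Valued.v (algebraMap (ValuedLaurentField ω hω) (WCompletion ω hω) x) = Valued.v x :=
  Valued.valuedCompletion_apply x

theorem valuation_ofPowerSeries (f : MvPowerSeries (Fin n) ℂ) :
    Valued.v (ofPowerSeries ω hω f) = norm ω f := by
  refine (valuation_algebraMap _).trans ?_
  change valuation ω hω (algebraMap _ (LaurentField n) f) = _
  exact Valuation.extendToLocalization_apply_map_apply _ _ _ _

theorem norm_eq_exp {f : MvPowerSeries (Fin n) ℂ} (hf : f ≠ 0) :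
    (norm ω f : ℝ) = Real.exp (-order ω f) := by
  rw [norm, if_neg hf, Real.coe_toNNReal _ (Real.exp_nonneg _)]

theorem ofPowerSeries_ne_zero {f : MvPowerSeries (Fin n) ℂ} (hf : f ≠ 0) :
    ofPowerSeries ω hω f ≠ 0 := by
  rw [← Valuation.ne_zero_iff Valued.v, valuation_ofPowerSeries]
  intro h
  have := norm_eq_exp (ω := ω) hf
  rw [h] at this
  exact (Real.exp_pos _).ne this

/-- The term `c x^α` in the completion. -/
noncomputable def term (ω : Fin n → ℝ) (hω : ∀ i, 0 < ω i) (c : ℂ) (α : Fin n → ℤ) :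
    WCompletion ω hω :=
  toCompletion ω hω (laurentTerm c α)

theorem term_eq (c : ℂ) (α : Fin n → ℤ) : term ω hω c α =
    ofPowerSeries ω hω (MvPowerSeries.C c) *
      ∏ i, ofPowerSeries ω hω (MvPowerSeries.X i) ^ α i := by
  rw [term, ← toCompletionHom_apply, laurentTerm, laurentMonomial, map_mul, map_prod]
  simp only [map_zpow₀]
  rfl

theorem X_ne_zero (i : Fin n) : (MvPowerSeries.X i : MvPowerSeries (Fin n) ℂ) ≠ 0 := fun h =>
  one_ne_zero (α := ℂ) (by
    simpa [MvPowerSeries.X_def] using congrArg (MvPowerSeries.coeff (Finsupp.single i 1)) h)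

theorem ofPowerSeries_X_ne_zero (i : Fin n) :
    ofPowerSeries ω hω (MvPowerSeries.X i) ≠ 0 :=
  ofPowerSeries_ne_zero (X_ne_zero i)

theorem term_mul_term (c d : ℂ) (α β : Fin n → ℤ) :
    term ω hω c α * term ω hω d β = term ω hω (c * d) (α + β) := by
  simp only [term_eq, map_mul, Pi.add_apply, zpow_add₀ (ofPowerSeries_X_ne_zero _),
    Finset.prod_mul_distrib]
  ring

theorem term_add (c d : ℂ) (α : Fin n → ℤ) :
    term ω hω (c + d) α = term ω hω c α + term ω hω d α := by
  simp only [term_eq, map_add, add_mul]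

theorem term_zero (α : Fin n → ℤ) : term ω hω 0 α = 0 := by
  simp [term_eq]

theorem term_one_zero : term ω hω 1 0 = 1 := by
  simp [term_eq]

theorem term_ne_zero {c : ℂ} (hc : c ≠ 0) (α : Fin n → ℤ) : term ω hω c α ≠ 0 := by
  intro h
  have := term_mul_term (hω := hω) c c⁻¹ α (-α)
  rw [h, zero_mul, mul_inv_cancel₀ hc, add_neg_cancel, term_one_zero] at this
  exact zero_ne_one this

theorem term_inv {c : ℂ} (hc : c ≠ 0) (α : Fin n → ℤ) :
    (term ω hω c α)⁻¹ = term ω hω c⁻¹ (-α) := by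
  refine inv_eq_of_mul_eq_one_right ?_
  rw [term_mul_term, mul_inv_cancel₀ hc, add_neg_cancel, term_one_zero]

theorem term_natExponent (c : ℂ) (α : Fin n →₀ ℕ) :
    term ω hω c (natExponent α) = ofPowerSeries ω hω (MvPowerSeries.monomial α c) := by
  rw [term_eq, MvPowerSeries.monomial_eq', Finsupp.prod_fintype _ _ (by simp)]
  simp [natExponent]

theorem order_monomial {c : ℂ} (hc : c ≠ 0) (hω : ∀ i, 0 < ω i) (α : Fin n →₀ ℕ) :
    order ω (MvPowerSeries.monomial α c) = weight ω α := by
  classical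
  have h0 : MvPowerSeries.monomial α c ≠ 0 := fun h => hc (by
    simpa using congrArg (MvPowerSeries.coeff α) h)
  obtain ⟨β, hβ, h⟩ := exists_coeff_ne_zero_of_ne_zero hω h0
  rw [MvPowerSeries.coeff_monomial] at hβ
  have : β = α := by by_contra h1; simp [h1] at hβ
  rw [← h, this]

theorem valuation_term {c : ℂ} (hc : c ≠ 0) (α : Fin n → ℤ) :
    ((Valued.v (term ω hω c α) : ℝ≥0) : ℝ) = Real.exp (-intWeight ω α) := by
  have hX : ∀ i, ((Valued.v (ofPowerSeries ω hω (MvPowerSeries.X i)) : ℝ≥0) : ℝ) = Real.exp (-ω i) := by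
    intro i
    rw [valuation_ofPowerSeries, norm_eq_exp (X_ne_zero i), MvPowerSeries.X,
      order_monomial one_ne_zero hω]
    simp [weight, Finsupp.single_apply]
  have hC : ((Valued.v (ofPowerSeries ω hω (MvPowerSeries.C c)) : ℝ≥0) : ℝ) = 1 := by
    rw [valuation_ofPowerSeries, norm_eq_exp, ← MvPowerSeries.monomial_zero_eq_C_apply,
      order_monomial hc hω]
    · simp [weight]
    · simpa using hc
  rw [term_eq, map_mul, map_prod, NNReal.coe_mul, hC, one_mul, NNReal.coe_prod, intWeight,
    ← Finset.sum_neg_distrib, Real.exp_sum]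
  refine Finset.prod_congr rfl fun i _ => ?_
  rw [map_zpow₀, NNReal.coe_zpow, hX, ← neg_mul, Real.exp_mul, Real.rpow_intCast]

theorem valuation_term_lt_iff {c d : ℂ} (hc : c ≠ 0) (hd : d ≠ 0) (α β : Fin n → ℤ) :
    Valued.v (term ω hω c α) < Valued.v (term ω hω d β) ↔ intWeight ω β < intWeight ω α := by
  rw [← NNReal.coe_lt_coe, valuation_term hc, valuation_term hd, Real.exp_lt_exp, neg_lt_neg_iff]

theorem valuation_term_lt_one_iff {c : ℂ} (hc : c ≠ 0) (α : Fin n → ℤ) :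
    Valued.v (term ω hω c α) < 1 ↔ 0 < intWeight ω α := by
  rw [← NNReal.coe_lt_coe, valuation_term hc, NNReal.coe_one, Real.exp_lt_one_iff, neg_lt_zero]

/-- The norm of a Laurent polynomial is at least the norm of each of its terms: the norms of the
terms are distinct, so that the sum has the norm of its largest term. -/
theorem valuation_term_le_sum (hlin : LinearIndependent ℚ ω) (p : (Fin n → ℤ) →₀ ℂ)
    {α : Fin n → ℤ} (hα : p α ≠ 0) :
    Valued.v (term ω hω 1 α) ≤ Valued.v (p.sum fun β c => term ω hω c β) := by
  obtain ⟨β, hβ, hmin⟩ := Finset.exists_min_image p.support (intWeight ω)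
    ⟨α, Finsupp.mem_support_iff.2 hα⟩
  have hβ0 := Finsupp.mem_support_iff.1 hβ
  have h1 : Valued.v (∑ δ ∈ p.support.erase β, term ω hω (p δ) δ) <
      Valued.v (term ω hω (p β) β) := by
    refine Valued.v.map_sum_lt ((Valuation.ne_zero_iff _).2 (term_ne_zero hβ0 β)) fun δ hδ => ?_
    obtain ⟨hne, hδ⟩ := Finset.mem_erase.1 hδ
    rw [valuation_term_lt_iff (Finsupp.mem_support_iff.1 hδ) hβ0]
    exact lt_of_le_of_ne (hmin δ hδ) fun h => hne (intWeight_injective hlin h).symm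
  rw [Finsupp.sum, ← Finset.add_sum_erase _ _ hβ, Valuation.map_add_eq_of_lt_left _ h1,
    ← not_lt, valuation_term_lt_iff hβ0 one_ne_zero, not_lt]
  exact hmin α (Finsupp.mem_support_iff.2 hα)

end Terms

/-! ### Limits of Laurent polynomials with prescribed exponents -/

section Support

open Filter Topology

variable {n : ℕ} {ω : Fin n → ℝ} {hω : ∀ i, 0 < ω i}

/-- The additive group of the elements of the completion which are limits of Laurent polynomials
with exponents in `T`. -/
noncomputable def supportedIn (ω : Fin n → ℝ) (hω : ∀ i, 0 < ω i) (T : Set (Fin n → ℤ)) :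
    AddSubgroup (WCompletion ω hω) :=
  (AddSubgroup.closure {x | ∃ c, ∃ α ∈ T, term ω hω c α = x}).topologicalClosure

theorem supportedIn_le {T : Set (Fin n → ℤ)} {A : AddSubgroup (WCompletion ω hω)}
    (hA : IsClosed (A : Set (WCompletion ω hω))) (h : ∀ c, ∀ α ∈ T, term ω hω c α ∈ A) :
    supportedIn ω hω T ≤ A := by
  refine AddSubgroup.topologicalClosure_minimal _ ((AddSubgroup.closure_le _).2 ?_) hA
  rintro _ ⟨c, α, hα, rfl⟩
  exact h c α hα

/-- The closed subring of the completion which consists of the limits of Laurent polynomials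
with exponents in the submonoid `M`. -/
noncomputable def supportedSubring (ω : Fin n → ℝ) (hω : ∀ i, 0 < ω i)
    (M : AddSubmonoid (Fin n → ℤ)) : Subring (WCompletion ω hω) :=
  (Subring.closure {x | ∃ c, ∃ α ∈ M, term ω hω c α = x}).topologicalClosure

theorem isClosed_supportedSubring (M : AddSubmonoid (Fin n → ℤ)) :
    IsClosed (supportedSubring ω hω M : Set (WCompletion ω hω)) :=
  Subring.isClosed_topologicalClosure _

theorem term_mem_supportedSubring {M : AddSubmonoid (Fin n → ℤ)} (c : ℂ) {α : Fin n → ℤ}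
    (hα : α ∈ M) : term ω hω c α ∈ supportedSubring ω hω M :=
  Subring.le_topologicalClosure _ (Subring.subset_closure ⟨c, α, hα, rfl⟩)

theorem supportedSubring_mono {M N : AddSubmonoid (Fin n → ℤ)} (h : M ≤ N) :
    supportedSubring ω hω M ≤ supportedSubring ω hω N := by
  refine Subring.topologicalClosure_minimal _ ((Subring.closure_le).2 ?_)
    (isClosed_supportedSubring N)
  rintro _ ⟨c, α, hα, rfl⟩
  exact term_mem_supportedSubring c (h hα)

/-- The terms with exponents in a submonoid are closed under multiplication, so that sums of such
terms already form a ring. -/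
theorem supportedSubring_le_supportedIn (M : AddSubmonoid (Fin n → ℤ)) {x : WCompletion ω hω}
    (hx : x ∈ supportedSubring ω hω M) : x ∈ supportedIn ω hω M := by
  refine closure_mono (fun y hy => ?_) hx
  let N : Submonoid (WCompletion ω hω) :=
    { carrier := {x | ∃ c, ∃ α ∈ M, term ω hω c α = x}
      one_mem' := ⟨1, 0, M.zero_mem, term_one_zero⟩
      mul_mem' := by
        rintro _ _ ⟨c, α, hα, rfl⟩ ⟨d, β, hβ, rfl⟩
        exact ⟨c * d, α + β, M.add_mem hα hβ, (term_mul_term c d α β).symm⟩ }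
  have h := Subring.mem_closure_iff.1 hy
  have e : Submonoid.closure {x | ∃ c, ∃ α ∈ M, term ω hω c α = x} = N := Submonoid.closure_eq N
  rw [e] at h
  exact h

theorem mul_term_mem {T : Set (Fin n → ℤ)} {M : AddSubmonoid (Fin n → ℤ)} {δ : Fin n → ℤ}
    (h : ∀ α ∈ T, α + δ ∈ M) {x : WCompletion ω hω} (hx : x ∈ supportedIn ω hω T) (c : ℂ) :
    x * term ω hω c δ ∈ supportedSubring ω hω M := by
  have hle : supportedIn ω hω T ≤ (supportedSubring ω hω M).toAddSubgroup.comap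
      (AddMonoidHom.mulRight (term ω hω c δ)) := by
    refine supportedIn_le ?_ fun d α hα => ?_
    · exact (isClosed_supportedSubring M).preimage (continuous_mul_const (term ω hω c δ))
    · change term ω hω d α * term ω hω c δ ∈ supportedSubring ω hω M
      rw [term_mul_term]
      exact term_mem_supportedSubring _ (h α hα)
  exact hle hx

/-- A power series is the limit of its truncations. -/
theorem ofPowerSeries_mem_supportedIn (f : MvPowerSeries (Fin n) ℂ) {T : Set (Fin n → ℤ)}
    (hT : ∀ α, MvPowerSeries.coeff α f ≠ 0 → natExponent α ∈ T) :
    ofPowerSeries ω hω f ∈ supportedIn ω hω T := by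
  classical
  refine mem_closure_iff_nhds.2 fun s hs => ?_
  obtain ⟨c, hc, hcs⟩ := exists_ball_subset hs
  have hvc : 0 < Valued.v c := pos_iff_ne_zero.2 ((Valuation.ne_zero_iff _).2 hc)
  -- The truncation at the weight `r` for which `exp (-r)` is the radius of the ball.
  set F := (finite_weight_le hω (-Real.log (Valued.v c : ℝ≥0))).toFinset with hF
  set g := ∑ α ∈ F, MvPowerSeries.monomial α (MvPowerSeries.coeff α f) with hg
  have hcoeff : ∀ α ∈ F, MvPowerSeries.coeff α (g - f) = 0 := by
    intro α hα
    rw [map_sub, hg, map_sum, Finset.sum_eq_single_of_mem α hα, MvPowerSeries.coeff_monomial_same,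
      sub_self]
    intro β _ hβ
    exact MvPowerSeries.coeff_monomial_ne hβ.symm _
  refine ⟨ofPowerSeries ω hω g, hcs _ ?_, ?_⟩
  · rw [← map_sub, valuation_ofPowerSeries]
    rcases eq_or_ne (g - f) 0 with h0 | h0
    · rw [h0, norm, if_pos rfl]
      exact hvc
    · obtain ⟨α, hα, h⟩ := exists_coeff_ne_zero_of_ne_zero hω h0
      have hlt : -Real.log (Valued.v c : ℝ≥0) < weight ω α := by
        by_contra! hle
        exact hα (hcoeff α (by simpa [hF] using hle))
      rw [← NNReal.coe_lt_coe, norm_eq_exp h0, ← Real.lt_log_iff_exp_lt (by exact_mod_cast hvc), ← h]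
      linarith
  · rw [hg, map_sum]
    refine AddSubgroup.sum_mem _ fun α _ => ?_
    rw [← term_natExponent]
    rcases eq_or_ne (MvPowerSeries.coeff α f) 0 with h0 | h0
    · rw [h0, term_zero]
      exact AddSubgroup.zero_mem _
    · exact AddSubgroup.subset_closure ⟨_, _, hT α h0, rfl⟩

/-- The group homomorphism from Laurent polynomials to the completion. -/
noncomputable def laurentPolynomialHom (ω : Fin n → ℝ) (hω : ∀ i, 0 < ω i) :
    ((Fin n → ℤ) →₀ ℂ) →+ WCompletion ω hω :=
  Finsupp.liftAddHom fun α => AddMonoidHom.mk' (fun c => term ω hω c α) fun c d => term_add c d α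

theorem laurentPolynomialHom_apply (p : (Fin n → ℤ) →₀ ℂ) :
    laurentPolynomialHom ω hω p = p.sum fun α c => term ω hω c α := rfl

theorem exists_approx {T : Set (Fin n → ℤ)} {z : WCompletion ω hω} (hz : z ∈ supportedIn ω hω T)
    {c : WCompletion ω hω} (hc : c ≠ 0) : ∃ p : (Fin n → ℤ) →₀ ℂ, (∀ α, p α ≠ 0 → α ∈ T) ∧
      Valued.v (laurentPolynomialHom ω hω p - z) < Valued.v c := by
  have hle : AddSubgroup.closure {x | ∃ c, ∃ α ∈ T, term ω hω c α = x} ≤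
      (Finsupp.supported ℂ ℂ T).toAddSubgroup.map (laurentPolynomialHom ω hω) := by
    refine (AddSubgroup.closure_le _).2 ?_
    rintro _ ⟨c, α, hα, rfl⟩
    refine ⟨Finsupp.single α c, Finsupp.single_mem_supported ℂ c hα, ?_⟩
    rw [laurentPolynomialHom_apply, Finsupp.sum_single_index (term_zero α)]
  have hev := eventually_valuation_lt (f := fun y : WCompletion ω hω => y - z) (x := z)
    (by fun_prop) (sub_self z) hc
  obtain ⟨y, hy, hyA⟩ := mem_closure_iff_nhds.1 hz _ hev
  obtain ⟨p, hp, rfl⟩ := hle hyA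
  exact ⟨p, fun α hα => (Finsupp.mem_supported ℂ p).1 hp (by simpa using hα), hy⟩

/-- A limit of Laurent polynomials with exponents in `T` is a Laurent series with exponents in `T`:
the coefficient of `x^α` is the same in all approximations up to an error of norm less than the norm
of `x^α`. -/
theorem exists_laurentExpansion (hlin : LinearIndependent ℚ ω) {T : Set (Fin n → ℤ)}
    {z : WCompletion ω hω} (hz : z ∈ supportedIn ω hω T) :
    ∃ c : (Fin n → ℤ) → ℂ, IsLaurentExpansion ω hω c z ∧ ∀ α, c α ≠ 0 → α ∈ T := by
  classical
  choose p hpT hp using fun α : Fin n → ℤ =>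
    exists_approx hz (term_ne_zero (hω := hω) one_ne_zero α)
  have stable : ∀ (q : (Fin n → ℤ) →₀ ℂ) (α : Fin n → ℤ),
      Valued.v (laurentPolynomialHom ω hω q - z) < Valued.v (term ω hω 1 α) →
      p α α = q α := by
    intro q α hq
    by_contra hne
    have h1 := valuation_term_le_sum (hω := hω) hlin (p α - q) (α := α) (by
      simpa using sub_ne_zero.2 hne)
    rw [← laurentPolynomialHom_apply, map_sub, ← sub_sub_sub_cancel_right _ _ z] at h1
    exact absurd h1 (not_le.2 ((Valued.v.map_sub _ _).trans_lt (max_lt (hp α) hq)))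
  refine ⟨fun α => p α α, ?_, fun α hα => hpT α α hα⟩
  intro s hs
  obtain ⟨r, hr, hrs⟩ := exists_ball_subset hs
  obtain ⟨q, -, hq⟩ := exists_approx hz hr
  refine mem_map.2 (mem_atTop_sets.2 ⟨q.support, fun F hF => hrs _ ?_⟩)
  have e : laurentPolynomialHom ω hω q = ∑ α ∈ F, term ω hω (q α) α := by
    rw [laurentPolynomialHom_apply]
    exact Finsupp.sum_of_support_subset _ hF _ fun α _ => term_zero α
  change Valued.v (∑ α ∈ F, term ω hω (p α α) α - z) < Valued.v r
  rw [← sub_add_sub_cancel _ (laurentPolynomialHom ω hω q) z]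
  refine (Valued.v.map_add _ _).trans_lt (max_lt ?_ hq)
  rw [e, ← Finset.sum_sub_distrib]
  refine Valued.v.map_sum_lt ((Valuation.ne_zero_iff _).2 hr) fun α _ => ?_
  rcases lt_or_ge (Valued.v (laurentPolynomialHom ω hω q - z)) (Valued.v (term ω hω 1 α)) with h | h
  · rw [stable q α h, sub_self, map_zero]
    exact pos_iff_ne_zero.2 ((Valuation.ne_zero_iff _).2 hr)
  · have e2 : term ω hω (p α α) α - term ω hω (q α) α = term ω hω (p α α - q α) α := by
      rw [sub_eq_iff_eq_add, ← term_add, sub_add_cancel]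
    rw [e2]
    rcases eq_or_ne (p α α - q α) 0 with h0 | h0
    · rw [h0, term_zero, map_zero]
      exact pos_iff_ne_zero.2 ((Valuation.ne_zero_iff _).2 hr)
    · refine lt_of_le_of_lt ?_ (h.trans_lt hq)
      rw [← not_lt, valuation_term_lt_iff one_ne_zero h0]
      exact lt_irrefl _

theorem IsLaurentExpansion.mul_term {c : (Fin n → ℤ) → ℂ} {z : WCompletion ω hω}
    (hc : IsLaurentExpansion ω hω c z) (γ : Fin n → ℤ) :
    IsLaurentExpansion ω hω (fun α => c (α - γ)) (z * term ω hω 1 γ) := by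
  rw [IsLaurentExpansion, ← (Equiv.addRight γ).hasSum_iff]
  have h := HasSum.mul_right (term ω hω 1 γ) hc
  refine Eq.subst (motive := fun f => HasSum f _) (funext fun α => ?_) h
  change term ω hω (c α) α * term ω hω 1 γ = term ω hω (c (α + γ - γ)) (α + γ)
  rw [term_mul_term, mul_one, add_sub_cancel_right]

end Support

/-! ### Algebraic elements and finitely generated cones -/

section Cones

variable {n : ℕ} {ω : Fin n → ℝ} {hω : ∀ i, 0 < ω i}

/-- The subring `supportedSubring` of the submonoid generated by a finite set of exponents. -/
noncomputable abbrev generatedSubring (ω : Fin n → ℝ) (hω : ∀ i, 0 < ω i)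
    (S : Finset (Fin n → ℤ)) : Subring (WCompletion ω hω) :=
  supportedSubring ω hω (AddSubmonoid.closure (S : Set (Fin n → ℤ)))

theorem generatedSubring_mono {S T : Finset (Fin n → ℤ)} (h : S ⊆ T) :
    generatedSubring ω hω S ≤ generatedSubring ω hω T :=
  supportedSubring_mono (AddSubmonoid.closure_mono (by exact_mod_cast h))

theorem const_mem_generatedSubring (c : ℂ) (S : Finset (Fin n → ℤ)) :
    term ω hω c 0 ∈ generatedSubring ω hω S :=
  term_mem_supportedSubring c (AddSubmonoid.zero_mem _)

/-- The translates by `-β` of the exponents of weight larger than that of `β` lie in a monoid with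
finitely many generators, all of positive weight. Indeed, let `N i` be such that `N i • eᵢ` has weight
larger than `β`: apart from finitely many, all exponents dominate some `N i • eᵢ`, so that the `eᵢ`,
the `N i • eᵢ - β` and the finitely many remaining translates suffice. -/
theorem exists_generators (hω : ∀ i, 0 < ω i) (A : Set (Fin n →₀ ℕ)) (β : Fin n → ℤ)
    (hA : ∀ α ∈ A, intWeight ω β < weight ω α) :
    ∃ S : Finset (Fin n → ℤ), (∀ s ∈ S, 0 < intWeight ω s) ∧
      ∀ α ∈ A, natExponent α - β ∈ AddSubmonoid.closure (S : Set (Fin n → ℤ)) := by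
  classical
  have hN : ∀ i, ∃ N : ℕ, intWeight ω β < ω i * N := fun i => by
    obtain ⟨N, hN⟩ := exists_nat_gt (intWeight ω β / ω i)
    exact ⟨N, by rwa [div_lt_iff₀' (hω i)] at hN⟩
  choose N hN using hN
  have hfin : {α ∈ A | ∀ i, α i ≤ N i}.Finite :=
    (Set.finite_Iic (Finsupp.equivFunOnFinite.symm N)).subset fun α hα i => by
      simpa using hα.2 i
  have hweight : ∀ i, intWeight ω (Pi.single i (N i : ℤ) : Fin n → ℤ) = ω i * N i := fun i => by
    simp [intWeight, Pi.single_apply]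
  have hsum : ∀ (m : Fin n → ℕ) (k : Fin n),
      (∑ j, m j • (Pi.single j 1 : Fin n → ℤ)) k = m k := fun m k => by
    simp [Finset.sum_apply, Pi.single_apply]
  refine ⟨Finset.univ.image (fun i => (Pi.single i 1 : Fin n → ℤ)) ∪
    Finset.univ.image (fun i => (Pi.single i (N i : ℤ) : Fin n → ℤ) - β) ∪
    hfin.toFinset.image (fun α => natExponent α - β), ?_, fun α hα => ?_⟩
  · intro s hs
    simp only [Finset.mem_union, Finset.mem_image, Finset.mem_univ, true_and,
      Set.Finite.mem_toFinset] at hs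
    rcases hs with (⟨i, rfl⟩ | ⟨i, rfl⟩) | ⟨α, hα, rfl⟩
    · simpa [intWeight, Pi.single_apply] using hω i
    · rw [intWeight_sub, hweight, sub_pos]
      exact hN i
    · rw [intWeight_sub, intWeight_natExponent, sub_pos]
      exact hA α hα.1
  · by_cases h : ∀ i, α i ≤ N i
    · refine AddSubmonoid.subset_closure ?_
      simp only [Finset.coe_union, Finset.coe_image]
      exact Or.inr ⟨α, by simpa using ⟨hα, h⟩, rfl⟩
    · push Not at h
      obtain ⟨i, hi⟩ := h
      have e : natExponent α - β = ((Pi.single i (N i : ℤ) : Fin n → ℤ) - β) +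
          ∑ j, (α j - if j = i then N i else 0) • (Pi.single j 1 : Fin n → ℤ) := by
        funext k
        rw [Pi.add_apply, hsum, Pi.sub_apply, Pi.sub_apply, Pi.single_apply, natExponent]
        rcases eq_or_ne k i with rfl | hk
        · simp only [if_true]
          omega
        · simp only [if_neg hk]
          omega
      rw [e]
      refine AddSubmonoid.add_mem _ (AddSubmonoid.subset_closure ?_)
        (AddSubmonoid.sum_mem _ fun j _ => AddSubmonoid.nsmul_mem _
          (AddSubmonoid.subset_closure ?_) _)
      · simp
      · simp

/-- A nonzero power series is, up to its initial term, a `1`-unit whose support lies in a finitely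
generated monoid. -/
theorem ofPowerSeries_eq_term_mul (hlin : LinearIndependent ℚ ω)
    {f : MvPowerSeries (Fin n) ℂ} (hf : f ≠ 0) :
    ∃ (c : ℂ) (β : Fin n → ℤ) (S : Finset (Fin n → ℤ)) (w : WCompletion ω hω), c ≠ 0 ∧
      (∀ s ∈ S, 0 < intWeight ω s) ∧ w ∈ generatedSubring ω hω S ∧ Valued.v w < 1 ∧
      ofPowerSeries ω hω f = term ω hω c β * (1 + w) := by
  classical
  obtain ⟨β, hβ, hord⟩ := exists_coeff_ne_zero_of_ne_zero hω hf
  set c := MvPowerSeries.coeff β f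
  set g := f - MvPowerSeries.monomial β c with hg
  have hgβ : ∀ α, MvPowerSeries.coeff α g ≠ 0 → intWeight ω (natExponent β) < weight ω α := by
    intro α hα
    have hne : α ≠ β := by
      rintro rfl
      exact hα (by rw [hg, map_sub, MvPowerSeries.coeff_monomial_same, sub_self])
    rw [hg, map_sub, MvPowerSeries.coeff_monomial_ne hne, sub_zero] at hα
    rw [intWeight_natExponent]
    refine lt_of_le_of_ne (hord.trans_le (order_le hω hα)) fun h => hne ?_
    rw [← intWeight_natExponent, ← intWeight_natExponent] at h
    exact (natExponent_injective (intWeight_injective hlin h)).symm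
  obtain ⟨S, hS, hmem⟩ := exists_generators hω {α | MvPowerSeries.coeff α g ≠ 0} _ hgβ
  have hT := ofPowerSeries_mem_supportedIn (hω := hω) g
    (T := natExponent '' {α | MvPowerSeries.coeff α g ≠ 0}) fun α hα => ⟨α, hα, rfl⟩
  have ht0 : term ω hω c (natExponent β) ≠ 0 := term_ne_zero hβ _
  refine ⟨c, natExponent β, S, ofPowerSeries ω hω g * term ω hω c⁻¹ (-natExponent β), hβ, hS,
    mul_term_mem ?_ hT _, ?_, ?_⟩
  · rintro _ ⟨α, hα, rfl⟩
    rw [← sub_eq_add_neg]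
    exact hmem α hα
  · rw [← term_inv hβ, map_mul, map_inv₀, ← div_eq_mul_inv,
      div_lt_one₀ (pos_iff_ne_zero.2 ((Valuation.ne_zero_iff _).2 ht0)), valuation_ofPowerSeries]
    rcases eq_or_ne g 0 with h0 | h0
    · rw [norm, if_pos h0]
      exact pos_iff_ne_zero.2 ((Valuation.ne_zero_iff _).2 ht0)
    · obtain ⟨α, hα, h⟩ := exists_coeff_ne_zero_of_ne_zero hω h0
      rw [← NNReal.coe_lt_coe, norm_eq_exp h0, valuation_term hβ, ← h, Real.exp_lt_exp,
        neg_lt_neg_iff]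
      exact hgβ α hα
  · rw [← term_inv hβ, mul_add, mul_one, mul_left_comm, mul_inv_cancel₀ ht0, mul_one,
      term_natExponent, ← map_add, hg, add_sub_cancel]

/-- The same as `ofPowerSeries_eq_term_mul`, for fractions of power series. -/
theorem algebraMap_eq_term_mul (hlin : LinearIndependent ℚ ω)
    {a : ValuedLaurentField ω hω} (ha : a ≠ 0) :
    ∃ (c : ℂ) (γ : Fin n → ℤ) (S : Finset (Fin n → ℤ)) (w : WCompletion ω hω), c ≠ 0 ∧
      (∀ s ∈ S, 0 < intWeight ω s) ∧ w ∈ generatedSubring ω hω S ∧ Valued.v w < 1 ∧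
      algebraMap _ (WCompletion ω hω) a = term ω hω c γ * (1 + w) := by
  classical
  obtain ⟨f, g, hg0, hfg⟩ := IsFractionRing.div_surjective (A := MvPowerSeries (Fin n) ℂ) a.ofVal
  have hg := nonZeroDivisors.ne_zero hg0
  have hf : f ≠ 0 := by
    rintro rfl
    rw [map_zero, zero_div] at hfg
    exact ha (WithVal.ofVal_injective _ hfg.symm)
  have e : algebraMap _ (WCompletion ω hω) a = ofPowerSeries ω hω f / ofPowerSeries ω hω g := by
    change toCompletionHom ω hω a.ofVal = _
    rw [← hfg, map_div₀]
    rfl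
  obtain ⟨c, β, S, w, hc, hS, hwS, hw, hfe⟩ := ofPowerSeries_eq_term_mul (hω := hω) hlin hf
  obtain ⟨d, δ, T, u, hd, hT, huT, hu, hge⟩ := ofPowerSeries_eq_term_mul (hω := hω) hlin hg
  have hwST := generatedSubring_mono (hω := hω) (Finset.subset_union_left (s₁ := S) (s₂ := T)) hwS
  have huST := generatedSubring_mono (hω := hω) (Finset.subset_union_right (s₁ := S) (s₂ := T)) huT
  have hu1 := one_add_ne_zero hu
  have hd0 : term ω hω d δ ≠ 0 := term_ne_zero hd δ
  refine ⟨c * d⁻¹, β + -δ, S ∪ T, (w - u) * (1 + u)⁻¹, mul_ne_zero hc (inv_ne_zero hd), ?_,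
    Subring.mul_mem _ (Subring.sub_mem _ hwST huST)
      (inv_one_add_mem (isClosed_supportedSubring _) huST hu), ?_, ?_⟩
  · intro s hs
    rcases Finset.mem_union.1 hs with h | h
    exacts [hS s h, hT s h]
  · rw [map_mul, map_inv₀, valuation_one_add hu, inv_one, mul_one]
    exact (Valued.v.map_sub _ _).trans_lt (max_lt hw hu)
  · rw [e, hfe, hge, ← term_mul_term, ← term_inv hd]
    field_simp
    ring

theorem algebraMap_mem_generatedSubring (hlin : LinearIndependent ℚ ω)
    (a : ValuedLaurentField ω hω) (ha : Valued.v (algebraMap _ (WCompletion ω hω) a) < 1) :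
    ∃ S : Finset (Fin n → ℤ), (∀ s ∈ S, 0 < intWeight ω s) ∧
      algebraMap _ (WCompletion ω hω) a ∈ generatedSubring ω hω S := by
  classical
  rcases eq_or_ne a 0 with rfl | h0
  · exact ⟨∅, by simp, by rw [map_zero]; exact Subring.zero_mem _⟩
  obtain ⟨c, γ, S, w, hc, hS, hwS, hw, e⟩ := algebraMap_eq_term_mul hlin h0
  rw [e, map_mul, valuation_one_add hw, mul_one, valuation_term_lt_one_iff hc] at ha
  refine ⟨insert γ S, ?_, ?_⟩
  · intro s hs
    rcases Finset.mem_insert.1 hs with rfl | h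
    exacts [ha, hS s h]
  · rw [e]
    refine Subring.mul_mem _ (term_mem_supportedSubring _ (AddSubmonoid.subset_closure ?_))
      (Subring.add_mem _ (Subring.one_mem _)
        (generatedSubring_mono (Finset.subset_insert _ _) hwS))
    simp

instance : CharZero (LaurentField n) :=
  charZero_of_injective_ringHom (f := (algebraMap (MvPowerSeries (Fin n) ℂ) (LaurentField n)).comp
    MvPowerSeries.C) (RingHom.injective _)

/-- An algebraic element of the completion is, up to a monomial, a series with exponents in a
monoid with finitely many generators, all of positive weight. -/
theorem exists_eq_term_mul_of_isAlgebraic (hlin : LinearIndependent ℚ ω) {ξ : WCompletion ω hω}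
    (hξ : IsAlgebraic (ValuedLaurentField ω hω) ξ) :
    ∃ (γ : Fin n → ℤ) (S : Finset (Fin n → ℤ)) (z : WCompletion ω hω),
      (∀ s ∈ S, 0 < intWeight ω s) ∧ z ∈ generatedSubring ω hω S ∧ ξ = z * term ω hω 1 γ := by
  classical
  by_cases hξK : ξ ∈ Set.range (algebraMap (ValuedLaurentField ω hω) (WCompletion ω hω))
  · obtain ⟨a, rfl⟩ := hξK
    rcases eq_or_ne a 0 with rfl | h0
    · exact ⟨0, ∅, 0, by simp, Subring.zero_mem _, by simp⟩
    obtain ⟨c, γ, S, w, hc, hS, hwS, hw, e⟩ := algebraMap_eq_term_mul hlin h0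
    refine ⟨γ, S, term ω hω c 0 * (1 + w), hS, Subring.mul_mem _ (const_mem_generatedSubring c S)
      (Subring.add_mem _ (Subring.one_mem _) hwS), ?_⟩
    rw [e, mul_right_comm, term_mul_term, mul_one, zero_add]
  · obtain ⟨a, b, η, Q, hab, ha0, hba, hη, hQ, hfix⟩ := exists_eq_add_mul_fixedPoint
      UniformSpace.Completion.denseRange_coe hξ hξK
    have haL : algebraMap _ (WCompletion ω hω) a ≠ 0 := by simpa using ha0
    obtain ⟨c, γ, S₀, w, hc, hS₀, hwS, hw, e⟩ := algebraMap_eq_term_mul hlin ha0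
    obtain ⟨S₁, hS₁, hbS⟩ := algebraMap_mem_generatedSubring (hω := hω) hlin (b / a) (by
      rw [map_div₀, map_div₀,
        div_lt_one₀ (pos_iff_ne_zero.2 ((Valuation.ne_zero_iff _).2 haL))]
      exact hba)
    choose U hU hQU using fun k => algebraMap_mem_generatedSubring (hω := hω) hlin _ (hQ k)
    set S := S₀ ∪ S₁ ∪ (Finset.range (Q.natDegree + 1)).biUnion U with hS
    have hQS : ∀ k, (Q.map (algebraMap _ (WCompletion ω hω))).coeff k ∈
        generatedSubring ω hω S := by
      intro k
      rw [Polynomial.coeff_map]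
      rcases Nat.lt_or_ge Q.natDegree k with hk | hk
      · rw [Polynomial.coeff_eq_zero_of_natDegree_lt hk, map_zero]
        exact Subring.zero_mem _
      · exact generatedSubring_mono ((Finset.subset_biUnion_of_mem U
          (Finset.mem_range.2 (by omega))).trans Finset.subset_union_right) (hQU k)
    have hηS : η ∈ generatedSubring ω hω S :=
      mem_of_eval_eq_self (isClosed_supportedSubring _) hQS
        (fun k => by rw [Polynomial.coeff_map]; exact hQ k) hη.le
        (by rw [Polynomial.eval_map_algebraMap, hfix])
    refine ⟨γ, S, term ω hω c 0 * (1 + w) * (1 + algebraMap _ (WCompletion ω hω) (b / a) * η),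
      ?_, ?_, ?_⟩
    · intro s hs
      simp only [hS, Finset.mem_union, Finset.mem_biUnion] at hs
      rcases hs with (h | h) | ⟨k, -, h⟩
      exacts [hS₀ s h, hS₁ s h, hU k s h]
    · have hw' := generatedSubring_mono (hω := hω)
        (show S₀ ⊆ S from Finset.subset_union_left.trans Finset.subset_union_left) hwS
      have hb' := generatedSubring_mono (hω := hω)
        (show S₁ ⊆ S from Finset.subset_union_right.trans Finset.subset_union_left) hbS
      exact Subring.mul_mem _ (Subring.mul_mem _ (const_mem_generatedSubring c S)
        (Subring.add_mem _ (Subring.one_mem _) hw'))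
        (Subring.add_mem _ (Subring.one_mem _) (Subring.mul_mem _ hb' hηS))
    · have e1 : term ω hω c 0 * (1 + w) * term ω hω 1 γ = algebraMap _ (WCompletion ω hω) a := by
        rw [e, mul_right_comm, term_mul_term, mul_one, zero_add]
      rw [mul_right_comm, e1, hab, map_div₀]
      field_simp

/-- A cone generated by vectors of positive weight contains no line, as it is contained in
a cone `|xᵢ| ≤ C * ⟨ω, x⟩`. -/
theorem isStronglyConvex_hull {S : Finset (Fin n → ℤ)} (hS : ∀ s ∈ S, 0 < intWeight ω s) :
    IsStronglyConvex (PointedCone.hull ℝ (toReal '' (S : Set (Fin n → ℤ)))) := by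
  obtain ⟨C, hC, hCS⟩ : ∃ C : ℝ, 0 < C ∧ ∀ s ∈ S, ∀ i, |toReal s i| ≤ C * intWeight ω s := by
    have hbd : ∀ s ∈ S, ∀ i, |toReal s i| / intWeight ω s ≤
        1 + ∑ t ∈ S, ∑ j, |toReal t j| / intWeight ω t := by
      intro s hs i
      have h1 : |toReal s i| / intWeight ω s ≤ ∑ j, |toReal s j| / intWeight ω s :=
        Finset.single_le_sum (f := fun j => |toReal s j| / intWeight ω s)
          (fun j _ => div_nonneg (abs_nonneg _) (hS s hs).le) (Finset.mem_univ i)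
      have h2 : ∑ j, |toReal s j| / intWeight ω s ≤ ∑ t ∈ S, ∑ j, |toReal t j| / intWeight ω t :=
        Finset.single_le_sum (f := fun t => ∑ j, |toReal t j| / intWeight ω t)
          (fun t ht => Finset.sum_nonneg fun j _ => div_nonneg (abs_nonneg _) (hS t ht).le) hs
      linarith
    have h0 : 0 ≤ ∑ t ∈ S, ∑ j, |toReal t j| / intWeight ω t := Finset.sum_nonneg fun t ht =>
      Finset.sum_nonneg fun j _ => div_nonneg (abs_nonneg _) (hS t ht).le
    refine ⟨_, add_pos_of_pos_of_nonneg one_pos h0, fun s hs i => ?_⟩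
    rw [← div_le_iff₀ (hS s hs)]
    exact hbd s hs i
  have hcone : ∀ x ∈ PointedCone.hull ℝ (toReal '' (S : Set (Fin n → ℤ))), ∀ i,
      |x i| ≤ C * ∑ j, ω j * x j := by
    intro x hx
    induction hx using Submodule.span_induction with
    | mem x hx =>
      obtain ⟨s, hs, rfl⟩ := hx
      exact hCS s hs
    | zero => simp
    | add x y _ _ hx hy =>
      intro i
      simp only [Pi.add_apply, mul_add, Finset.sum_add_distrib]
      exact (abs_add_le _ _).trans (add_le_add (hx i) (hy i))
    | smul r x _ hx =>
      intro i
      have e : ∑ j, ω j * (r • x) j = (r : ℝ) * ∑ j, ω j * x j := by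
        rw [Finset.mul_sum]
        refine Finset.sum_congr rfl fun j _ => ?_
        change ω j * ((r : ℝ) * x j) = _
        ring
      rw [e]
      change |(r : ℝ) * x i| ≤ _
      rw [abs_mul, abs_of_nonneg r.2, mul_left_comm]
      exact mul_le_mul_of_nonneg_left (hx i) r.2
  rintro ⟨p, v, hv, h⟩
  obtain ⟨i, hi⟩ := Function.ne_iff.1 hv
  set W := ∑ j, ω j * v j with hW
  set P := ∑ j, ω j * p j with hP
  have key : ∀ t : ℝ, |p i + t * v i| ≤ C * (P + t * W) := by
    intro t
    have := hcone _ (h t) i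
    have e : ∑ j, ω j * (p + t • v) j = P + t * W := by
      rw [hP, hW, Finset.mul_sum, ← Finset.sum_add_distrib]
      refine Finset.sum_congr rfl fun j _ => ?_
      simp only [Pi.add_apply, Pi.smul_apply, smul_eq_mul]
      ring
    rwa [e] at this
  -- The sum of the bounds at `t` and `-t` bounds `2 * |t * v i|` independently of `t`.
  have hbound : ∀ t : ℝ, t * v i ≤ C * P := by
    intro t
    have h1 := (le_abs_self _).trans (key t)
    have h2 := (neg_le_abs _).trans (key (-t))
    linarith
  have := hbound ((C * P + 1) / v i)
  rw [div_mul_cancel₀ _ hi] at this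
  linarith

theorem toReal_mem_hull {S : Finset (Fin n → ℤ)} {α : Fin n → ℤ}
    (hα : α ∈ AddSubmonoid.closure (S : Set (Fin n → ℤ))) :
    toReal α ∈ PointedCone.hull ℝ (toReal '' (S : Set (Fin n → ℤ))) := by
  induction hα using AddSubmonoid.closure_induction with
  | mem x hx => exact Submodule.subset_span ⟨x, hx, rfl⟩
  | zero =>
    convert Submodule.zero_mem _
    funext i
    simp [toReal]
  | add x y _ _ hx hy =>
    convert Submodule.add_mem _ hx hy
    funext i
    simp [toReal]

end Cones

end MacDonald

theorem mainTheorem5 (n : ℕ) (ω : Fin n → ℝ) (hω : ∀ i, 0 < ω i)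
    (hlin : LinearIndependent ℚ ω) (ξ : MacDonald.WCompletion ω hω)
    (hξ : IsAlgebraic (MacDonald.ValuedLaurentField ω hω) ξ) :
    ∃ c : (Fin n → ℤ) → ℂ, MacDonald.IsLaurentExpansion ω hω c ξ ∧
      ∃ (γ : Fin n → ℤ) (σ : PointedCone ℝ (Fin n → ℝ)),
        MacDonald.IsRationalPolyhedral σ ∧ MacDonald.IsStronglyConvex σ ∧
        ∀ α : Fin n → ℤ, c α ≠ 0 →
          ∃ s ∈ σ, MacDonald.toReal α = MacDonald.toReal γ + s := by
  open MacDonald in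
  obtain ⟨γ, S, z, hS, hz, rfl⟩ := exists_eq_term_mul_of_isAlgebraic hlin hξ
  obtain ⟨c, hc, hcS⟩ := exists_laurentExpansion hlin (supportedSubring_le_supportedIn _ hz)
  refine ⟨fun α => c (α - γ), hc.mul_term γ, γ, _, ⟨S, rfl⟩, isStronglyConvex_hull hS, fun α hα =>
    ⟨_, toReal_mem_hull (hcS _ hα), ?_⟩⟩
  · funext i
    simp [toReal]
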